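/- Let $\mathbf{var}$ be an infinite type of variables and $\mathbf{const}$ a type of constants. Terms $X,Y$ and values $V,W$ are given by the two-sorted grammar $$X ::= \mathsf{Val}\,V \mid \mathsf{App}\,X\,Y,\qquad V ::= \mathsf{Var}\,x \mid \mathsf{Ct}\,c \mid \mathsf{Lm}\,x\,X,$$ where $\mathsf{Lm}\,x\,X$ binds $x$ in $X$; terms and values are taken modulo alpha-equivalence, and $X[W/y]$ is the capture-avoiding substitution of the value $W$ for $y$ in $X$. Let $\mathsf{Ctapp}$ be a partial function that sends a pair of constants to a value, all results of which are closed (have no free variables). One-step call-by-value (CBV) reduction $\to$ is the relation on terms defined inductively by the rules: $(\beta)$ $\mathsf{App}\,(\mathsf{Val}(\mathsf{Lm}\,y\,X))\,(\mathsf{Val}\,W)\to X[W/y]$; $(\delta)$ if $\mathsf{Ctapp}\,c_1\,c_2=\mathsf{Some}\,V$ then $\mathsf{App}\,(\mathsf{Val}(\mathsf{Ct}\,c_1))\,(\mathsf{Val}(\mathsf{Ct}\,c_2))\to\mathsf{Val}\,V$; (AppL) if $X\to X'$ then $\mathsf{App}\,X\,Y\to\mathsf{App}\,X'\,Y$; (AppR)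 if $Y\to Y'$ then $\mathsf{App}\,X\,Y\to\mathsf{App}\,X\,Y'$; $(\xi)$ if $X\to X'$ then $\mathsf{Val}(\mathsf{Lm}\,y\,X)\to\mathsf{Val}(\mathsf{Lm}\,y\,X')$. Multi-step CBV reduction $\to^*$ is the reflexive-transitive closure of $\to$. One-step left CBV reduction $\to_L$ is defined inductively by the rules $(\beta)$, $(\delta)$ and (AppL) above (with $\to_L$ in place of $\to$) and the rule: if $Y\to_L Y'$ then $\mathsf{App}\,(\mathsf{Val}\,V)\,Y\to_L\mathsf{App}\,(\mathsf{Val}\,V)\,Y'$. The standard reduction sequences are the lists of terms defined inductively as follows: $[\mathsf{Val}(\mathsf{Ct}\,c)]$ and $[\mathsf{Val}(\mathsf{Var}\,x)]$ are standard; if $[X_1,\dots,X_n]$ is standard and $X\to_L X_1$, then $[X,X_1,\dots,X_n]$ is standard; if $[X_1,\dots,X_n]$ is standard, then so is $[\mathsf{Val}(\mathsf{Lm}\,x\,X_1),\dots,\mathsf{Val}(\mathsf{Lm}\,x\,X_n)]$; if $[X_1,\dots,X_n]$ and $[Y_1,\dots,Y_m]$ are standard, then so is $[\mathsf{App}\,X_1\,Y_1,\dots,\mathsf{App}\,X_n\,Y_1,\mathsf{App}\,X_n\,Y_2,\dots,\mathsf{App}\,X_n\,Y_m]$.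 Then: (1) (Church-Rosser) $\to^*$ is confluent: if $X\to^* Y_1$ and $X\to^* Y_2$, then there is a term $Z$ with $Y_1\to^* Z$ and $Y_2\to^* Z$. (2) (Standardization) For all terms $X,X'$: $X\to^* X'$ if and only if there is a standard reduction sequence that starts in $X$ and ends in $X'$. -/

import Mathlib

namespace CBV

universe u v

/-! ## Quasi-terms: the raw two-sorted syntax, with named bound variables -/

mutual
/-- Quasi-terms `X ::= Val W | App X Y`. -/
inductive QTerm (V : Type u) (C : Type v) : Type (max u v)
  | val : QValue V C → QTerm V C
  | app : QTerm V C → QTerm V C → QTerm V C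

/-- Quasi-values `W ::= Var x | Ct c | Lm x X`, where `Lm x X` binds `x` in `X`. -/
inductive QValue (V : Type u) (C : Type v) : Type (max u v)
  | var : V → QValue V C
  | ct : C → QValue V C
  | lm : V → QTerm V C → QValue V C
end

section Raw

variable {V : Type u} {C : Type v}

mutual
/-- The action of a permutation of the variables on all variables (free, bound and binding). -/
def QTerm.perm (π : Equiv.Perm V) : QTerm V C → QTerm V C
  | .val W => .val (QValue.perm π W)
  | .app X Y => .app (QTerm.perm π X) (QTerm.perm π Y)

/-- The action of a permutation of the variables on all variables (free, bound and binding). -/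
def QValue.perm (π : Equiv.Perm V) : QValue V C → QValue V C
  | .var x => .var (π x)
  | .ct c => .ct c
  | .lm x X => .lm (π x) (QTerm.perm π X)
end

variable [DecidableEq V]

mutual
/-- The free variables of a quasi-term. -/
def QTerm.fv : QTerm V C → Finset V
  | .val W => QValue.fv W
  | .app X Y => QTerm.fv X ∪ QTerm.fv Y

/-- The free variables of a quasi-value. -/
def QValue.fv : QValue V C → Finset V
  | .var x => {x}
  | .ct _ => ∅
  | .lm x X => (QTerm.fv X).erase x
end

mutual
/-- Alpha-equivalence of quasi-terms. -/
inductive QTerm.Alpha : QTerm V C → QTerm V C → Prop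
  | refl (X) : QTerm.Alpha X X
  | symm {X Y} : QTerm.Alpha X Y → QTerm.Alpha Y X
  | trans {X Y Z} : QTerm.Alpha X Y → QTerm.Alpha Y Z → QTerm.Alpha X Z
  | val {W W'} : QValue.Alpha W W' → QTerm.Alpha (.val W) (.val W')
  | app {X X' Y Y'} : QTerm.Alpha X X' → QTerm.Alpha Y Y' →
      QTerm.Alpha (.app X Y) (.app X' Y')

/-- Alpha-equivalence of quasi-values: the least congruence that allows the renaming of a bound
variable `x` into a variable `y` that is not free in the scope (by swapping `x` and `y`, which
cannot capture). -/
inductive QValue.Alpha : QValue V C → QValue V C → Prop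
  | refl (W) : QValue.Alpha W W
  | symm {W W'} : QValue.Alpha W W' → QValue.Alpha W' W
  | trans {W W' W''} : QValue.Alpha W W' → QValue.Alpha W' W'' → QValue.Alpha W W''
  | lm {x X X'} : QTerm.Alpha X X' → QValue.Alpha (.lm x X) (.lm x X')
  | rename {x y X} : y ∉ QTerm.fv X →
      QValue.Alpha (.lm x X) (.lm y (QTerm.perm (Equiv.swap x y) X))
end

instance QTerm.setoid : Setoid (QTerm V C) where
  r := QTerm.Alpha
  iseqv := ⟨.refl, .symm, .trans⟩

instance QValue.setoid : Setoid (QValue V C) where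
  r := QValue.Alpha
  iseqv := ⟨.refl, .symm, .trans⟩

/-- A variable outside a given finite set. -/
noncomputable def freshVar [Infinite V] (s : Finset V) : V :=
  Classical.choose (Infinite.exists_notMem_finset s)

/-- The free variables that the substitution `σ` brings in for those in `s`. -/
def imageFv (σ : V → QValue V C) (s : Finset V) : Finset V :=
  s.biUnion fun u => QValue.fv (σ u)

mutual
/-- Capture-avoiding simultaneous substitution in a quasi-term. -/
noncomputable def QTerm.subst [Infinite V] : (V → QValue V C) → QTerm V C → QTerm V C
  | σ, .val W => .val (QValue.subst σ W)
  | σ, .app X Y => .app (QTerm.subst σ X) (QTerm.subst σ Y)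

/-- Capture-avoiding simultaneous substitution in a quasi-value. The bound variable of an
abstraction is always renamed to one that is not free in any of the substituted values. -/
noncomputable def QValue.subst [Infinite V] : (V → QValue V C) → QValue V C → QValue V C
  | σ, .var x => σ x
  | _, .ct c => .ct c
  | σ, .lm x X =>
      let z := freshVar (imageFv σ ((QTerm.fv X).erase x))
      .lm z (QTerm.subst (Function.update σ x (.var z)) X)
end

/-! ### Free variables and substitution respect alpha-equivalence -/

mutual
theorem QTerm.fv_perm (π : Equiv.Perm V) : ∀ X : QTerm V C,
    QTerm.fv (QTerm.perm π X) = (QTerm.fv X).image π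
  | .val W => by simp only [QTerm.perm, QTerm.fv, QValue.fv_perm π W]
  | .app X Y => by
      simp only [QTerm.perm, QTerm.fv, QTerm.fv_perm π X, QTerm.fv_perm π Y, Finset.image_union]

theorem QValue.fv_perm (π : Equiv.Perm V) : ∀ W : QValue V C,
    QValue.fv (QValue.perm π W) = (QValue.fv W).image π
  | .var x => by simp [QValue.perm, QValue.fv]
  | .ct _ => by simp [QValue.perm, QValue.fv]
  | .lm x X => by
      simp only [QValue.perm, QValue.fv, QTerm.fv_perm π X, Finset.image_erase π.injective]
end

theorem erase_image_swap {s : Finset V} {x y : V} (hy : y ∉ s) :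
    (s.image (Equiv.swap x y)).erase y = s.erase x := by
  ext w
  simp only [Finset.mem_erase, Finset.mem_image]
  constructor
  · rintro ⟨hw, a, ha, rfl⟩
    by_cases hax : a = x
    · subst hax; simp at hw
    · have hay : a ≠ y := fun h => hy (h ▸ ha)
      rw [Equiv.swap_apply_of_ne_of_ne hax hay]
      exact ⟨hax, ha⟩
  · rintro ⟨hwx, hw⟩
    have hwy : w ≠ y := fun h => hy (h ▸ hw)
    exact ⟨hwy, w, hw, Equiv.swap_apply_of_ne_of_ne hwx hwy⟩

mutual
theorem QTerm.Alpha.fv_eq : ∀ {X Y : QTerm V C}, QTerm.Alpha X Y → QTerm.fv X = QTerm.fv Y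
  | _, _, .refl _ => rfl
  | _, _, .symm h => (QTerm.Alpha.fv_eq h).symm
  | _, _, .trans h h' => (QTerm.Alpha.fv_eq h).trans (QTerm.Alpha.fv_eq h')
  | _, _, .val h => by simp only [QTerm.fv, QValue.Alpha.fv_eq h]
  | _, _, .app h h' => by simp only [QTerm.fv, QTerm.Alpha.fv_eq h, QTerm.Alpha.fv_eq h']

theorem QValue.Alpha.fv_eq : ∀ {W W' : QValue V C}, QValue.Alpha W W' →
    QValue.fv W = QValue.fv W'
  | _, _, .refl _ => rfl
  | _, _, .symm h => (QValue.Alpha.fv_eq h).symm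
  | _, _, .trans h h' => (QValue.Alpha.fv_eq h).trans (QValue.Alpha.fv_eq h')
  | _, _, .lm h => by simp only [QValue.fv, QTerm.Alpha.fv_eq h]
  | _, _, .rename hy => by
      simp only [QValue.fv, QTerm.fv_perm]
      exact (erase_image_swap hy).symm
end

theorem imageFv_congr {σ τ : V → QValue V C} {s : Finset V}
    (h : ∀ u ∈ s, QValue.fv (σ u) = QValue.fv (τ u)) : imageFv σ s = imageFv τ s :=
  Finset.biUnion_congr rfl h

theorem update_alpha {σ τ : V → QValue V C} (h : ∀ u, QValue.Alpha (σ u) (τ u)) (x : V)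
    {W W' : QValue V C} (hW : QValue.Alpha W W') (u : V) :
    QValue.Alpha (Function.update σ x W u) (Function.update τ x W' u) := by
  by_cases hux : u = x
  · subst hux; simpa using hW
  · rw [Function.update_of_ne hux, Function.update_of_ne hux]; exact h u

variable [Infinite V]

mutual
theorem QTerm.subst_congr : ∀ (σ τ : V → QValue V C) (X : QTerm V C),
    (∀ u ∈ QTerm.fv X, σ u = τ u) → QTerm.subst σ X = QTerm.subst τ X
  | σ, τ, .val W, h => by
      simp only [QTerm.subst]
      rw [QValue.subst_congr σ τ W h]
  | σ, τ, .app X Y, h => by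
      simp only [QTerm.subst]
      rw [QTerm.subst_congr σ τ X fun u hu => h u (Finset.mem_union_left _ hu),
        QTerm.subst_congr σ τ Y fun u hu => h u (Finset.mem_union_right _ hu)]

theorem QValue.subst_congr : ∀ (σ τ : V → QValue V C) (W : QValue V C),
    (∀ u ∈ QValue.fv W, σ u = τ u) → QValue.subst σ W = QValue.subst τ W
  | _, _, .var x, h => by
      simp only [QValue.subst]
      exact h x (by simp [QValue.fv])
  | _, _, .ct _, _ => by simp only [QValue.subst]
  | σ, τ, .lm x X, h => by
      simp only [QValue.subst]
      rw [imageFv_congr (σ := σ) (τ := τ) (s := (QTerm.fv X).erase x)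
        fun u hu => congrArg QValue.fv (h u hu)]
      congr 1
      refine QTerm.subst_congr _ _ X fun u hu => ?_
      by_cases hux : u = x
      · subst hux; simp
      · rw [Function.update_of_ne hux, Function.update_of_ne hux]
        exact h u (Finset.mem_erase.2 ⟨hux, hu⟩)
end

mutual
theorem QTerm.subst_perm (π : Equiv.Perm V) : ∀ (σ : V → QValue V C) (X : QTerm V C),
    QTerm.subst σ (QTerm.perm π X) = QTerm.subst (fun u => σ (π u)) X
  | σ, .val W => by simp only [QTerm.perm, QTerm.subst, QValue.subst_perm π σ W]
  | σ, .app X Y => by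
      simp only [QTerm.perm, QTerm.subst, QTerm.subst_perm π σ X, QTerm.subst_perm π σ Y]

theorem QValue.subst_perm (π : Equiv.Perm V) : ∀ (σ : V → QValue V C) (W : QValue V C),
    QValue.subst σ (QValue.perm π W) = QValue.subst (fun u => σ (π u)) W
  | _, .var _ => by simp only [QValue.perm, QValue.subst]
  | _, .ct _ => by simp only [QValue.perm, QValue.subst]
  | σ, .lm x X => by
      have e : imageFv σ ((QTerm.fv (QTerm.perm π X)).erase (π x)) =
          imageFv (fun u => σ (π u)) ((QTerm.fv X).erase x) := by
        rw [QTerm.fv_perm, ← Finset.image_erase π.injective]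
        simp only [imageFv, Finset.image_biUnion]
      simp only [QValue.perm, QValue.subst]
      rw [e, QTerm.subst_perm π _ X]
      congr 2
      funext u
      by_cases hux : u = x
      · subst hux; simp
      · rw [Function.update_of_ne hux, Function.update_of_ne (fun h => hux (π.injective h))]
end

mutual
theorem QTerm.Alpha.subst_eq : ∀ {X Y : QTerm V C}, QTerm.Alpha X Y →
    ∀ σ : V → QValue V C, QTerm.subst σ X = QTerm.subst σ Y
  | _, _, .refl _, _ => rfl
  | _, _, .symm h, σ => (QTerm.Alpha.subst_eq h σ).symm
  | _, _, .trans h h', σ => (QTerm.Alpha.subst_eq h σ).trans (QTerm.Alpha.subst_eq h' σ)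
  | _, _, .val h, σ => by simp only [QTerm.subst, QValue.Alpha.subst_eq h σ]
  | _, _, .app h h', σ => by
      simp only [QTerm.subst, QTerm.Alpha.subst_eq h σ, QTerm.Alpha.subst_eq h' σ]

theorem QValue.Alpha.subst_eq : ∀ {W W' : QValue V C}, QValue.Alpha W W' →
    ∀ σ : V → QValue V C, QValue.subst σ W = QValue.subst σ W'
  | _, _, .refl _, _ => rfl
  | _, _, .symm h, σ => (QValue.Alpha.subst_eq h σ).symm
  | _, _, .trans h h', σ => (QValue.Alpha.subst_eq h σ).trans (QValue.Alpha.subst_eq h' σ)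
  | _, _, .lm h, σ => by
      simp only [QValue.subst]
      rw [QTerm.Alpha.fv_eq h, QTerm.Alpha.subst_eq h]
  | _, _, .rename (x := x) (y := y) (X := X) hy, σ => by
      simp only [QValue.subst]
      rw [QTerm.fv_perm, erase_image_swap hy, QTerm.subst_perm]
      congr 1
      refine QTerm.subst_congr _ _ X fun u hu => ?_
      have huy : u ≠ y := fun h => hy (h ▸ hu)
      by_cases hux : u = x
      · subst hux; simp
      · rw [Equiv.swap_apply_of_ne_of_ne hux huy, Function.update_of_ne hux,
          Function.update_of_ne huy]
end

mutual
theorem QTerm.subst_alpha : ∀ (σ τ : V → QValue V C) (X : QTerm V C),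
    (∀ u, QValue.Alpha (σ u) (τ u)) → QTerm.Alpha (QTerm.subst σ X) (QTerm.subst τ X)
  | σ, τ, .val W, h => by
      simp only [QTerm.subst]
      exact .val (QValue.subst_alpha σ τ W h)
  | σ, τ, .app X Y, h => by
      simp only [QTerm.subst]
      exact .app (QTerm.subst_alpha σ τ X h) (QTerm.subst_alpha σ τ Y h)

theorem QValue.subst_alpha : ∀ (σ τ : V → QValue V C) (W : QValue V C),
    (∀ u, QValue.Alpha (σ u) (τ u)) → QValue.Alpha (QValue.subst σ W) (QValue.subst τ W)
  | _, _, .var x, h => by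
      simp only [QValue.subst]
      exact h x
  | _, _, .ct c, _ => by
      simp only [QValue.subst]
      exact .refl _
  | σ, τ, .lm x X, h => by
      simp only [QValue.subst]
      rw [imageFv_congr fun u _ => QValue.Alpha.fv_eq (h u)]
      exact .lm (QTerm.subst_alpha _ _ X (update_alpha h x (.refl _)))
end

end Raw

/-! ## Terms and values: alpha-equivalence classes -/

/-- Terms: alpha-equivalence classes of quasi-terms. -/
def Term (V : Type u) (C : Type v) [DecidableEq V] : Type (max u v) :=
  Quotient (QTerm.setoid (V := V) (C := C))

/-- Values: alpha-equivalence classes of quasi-values. -/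
def Value (V : Type u) (C : Type v) [DecidableEq V] : Type (max u v) :=
  Quotient (QValue.setoid (V := V) (C := C))

section Calculus

variable {V : Type u} {C : Type v} [DecidableEq V]

/-- The value `Var x`. -/
def Var (x : V) : Value V C := Quotient.mk _ (.var x)

/-- The value `Ct c`. -/
def Ct (c : C) : Value V C := Quotient.mk _ (.ct c)

/-- The value `Lm x X`. -/
def Lm (x : V) : Term V C → Value V C :=
  Quotient.map (.lm x) fun _ _ h => .lm h

/-- The term `Val W`. -/
def Val : Value V C → Term V C :=
  Quotient.map .val fun _ _ h => .val h

/-- The term `App X Y`. -/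
def App : Term V C → Term V C → Term V C :=
  Quotient.map₂ .app fun _ _ h _ _ h' => .app h h'

/-- The free variables of a value. -/
def Value.fv : Value V C → Finset V :=
  Quotient.lift QValue.fv fun _ _ h => QValue.Alpha.fv_eq h

/-- `X.subst W y` is `X[W / y]`, the capture-avoiding substitution of the value `W` for the
variable `y` in the term `X`. -/
noncomputable def Term.subst [Infinite V] (X : Term V C) (W : Value V C) (y : V) : Term V C :=
  Quotient.map₂ (fun (X : QTerm V C) (W : QValue V C) =>
      QTerm.subst (Function.update QValue.var y W) X)
    (fun X X' hX W W' hW => by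
      change QTerm.Alpha _ _
      rw [QTerm.Alpha.subst_eq hX]
      exact QTerm.subst_alpha _ _ X' (update_alpha (fun _ => .refl _) y hW)) X W

variable [Infinite V]

/-- One-step call-by-value reduction, where `Ctapp` gives the meaning of the application of a
constant to a constant. -/
inductive Red (Ctapp : C → C → Option (Value V C)) : Term V C → Term V C → Prop
  | beta (y : V) (X : Term V C) (W : Value V C) :
      Red Ctapp (App (Val (Lm y X)) (Val W)) (X.subst W y)
  | delta {c₁ c₂ : C} {W : Value V C} : Ctapp c₁ c₂ = some W →
      Red Ctapp (App (Val (Ct c₁)) (Val (Ct c₂))) (Val W)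
  | appL {X X' : Term V C} (Y : Term V C) : Red Ctapp X X' → Red Ctapp (App X Y) (App X' Y)
  | appR (X : Term V C) {Y Y' : Term V C} : Red Ctapp Y Y' → Red Ctapp (App X Y) (App X Y')
  | xi (y : V) {X X' : Term V C} : Red Ctapp X X' → Red Ctapp (Val (Lm y X)) (Val (Lm y X'))

/-- Multi-step call-by-value reduction: the reflexive-transitive closure of one-step reduction. -/
def MRed (Ctapp : C → C → Option (Value V C)) : Term V C → Term V C → Prop :=
  Relation.ReflTransGen (Red Ctapp)

/-- One-step left call-by-value reduction. -/
inductive LRed (Ctapp : C → C → Option (Value V C)) : Term V C → Term V C → Prop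
  | delta {c₁ c₂ : C} {W : Value V C} : Ctapp c₁ c₂ = some W →
      LRed Ctapp (App (Val (Ct c₁)) (Val (Ct c₂))) (Val W)
  | beta (y : V) (X : Term V C) (W : Value V C) :
      LRed Ctapp (App (Val (Lm y X)) (Val W)) (X.subst W y)
  | appL {X X' : Term V C} (Y : Term V C) : LRed Ctapp X X' → LRed Ctapp (App X Y) (App X' Y)
  | appR (W : Value V C) {Y Y' : Term V C} : LRed Ctapp Y Y' →
      LRed Ctapp (App (Val W) Y) (App (Val W) Y')

/-- `zipApp [X₁, …, Xₙ] [Y₁, …, Yₘ] = [App X₁ Y₁, …, App Xₙ Y₁, App Xₙ Y₂, …, App Xₙ Yₘ]` for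
`n, m ≥ 1`; it is only used for nonempty lists. -/
def zipApp : List (Term V C) → List (Term V C) → List (Term V C)
  | X :: Xs, Y :: Ys =>
      (X :: Xs).map (fun Z => App Z Y) ++ Ys.map (App ((X :: Xs).getLast (List.cons_ne_nil X Xs)))
  | _, _ => []

/-- Standard reduction sequences. -/
inductive Srs (Ctapp : C → C → Option (Value V C)) : List (Term V C) → Prop
  | ct (c : C) : Srs Ctapp [Val (Ct c)]
  | var (x : V) : Srs Ctapp [Val (Var x)]
  | red {X Y : Term V C} {Xs : List (Term V C)} : Xs.head? = some Y → LRed Ctapp X Y →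
      Srs Ctapp Xs → Srs Ctapp (X :: Xs)
  | lm (x : V) {Xs : List (Term V C)} : Srs Ctapp Xs → Srs Ctapp (Xs.map fun X => Val (Lm x X))
  | app {Xs Ys : List (Term V C)} : Srs Ctapp Xs → Srs Ctapp Ys → Srs Ctapp (zipApp Xs Ys)

end Calculus

/-- A relation is confluent if every span can be joined in one step (diamond property). -/
def Confluent {α : Type*} (r : α → α → Prop) : Prop :=
  ∀ u v₁ v₂, r u v₁ → r u v₂ → ∃ w, r v₁ w ∧ r v₂ w

end CBV

-- Both halves rest on one feature of call-by-value: only values are substituted, and a value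
-- remains a value under substitution and under reduction. Hence redexes survive both. Closedness of
-- the constants' results makes δ-steps stable under substitution and keeps reduction from creating
-- free variables.
--
-- Church-Rosser is the Tait and Martin-Löf argument. Parallel reduction `Par` lies between `Red`
-- and `MRed`, so it has the same reflexive-transitive closure; it is compatible with substitution
-- (`Par.ssubst`), and this gives the diamond property (`Par.confluent`).
--
-- Standardization goes through the inductive relation `Std`: left reduction to a term of the right
-- shape, then standard reduction inside its immediate subterms. The crux is `Std.tail`, that `Std`
-- absorbs an arbitrary further `Red` step; hence `MRed` is contained in `Std`. A `Std` derivation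
-- has the same shape as a derivation of `Srs`, which yields the sequence; conversely, every
-- standard sequence consists of legitimate reductions.
--
-- The remaining work concerns binders. Substitution on classes may use any fresh bound variable
-- (`Value.ssubst_Lm`), and a β-contractum does not depend on the displayed binder (`Lm_eq_subst`).

namespace CBV

universe u v

-- Permutations and substitution on quasi-terms, up to alpha-equivalence.

section RawLemmas

variable {V : Type u} {C : Type v}

mutual
theorem QTerm.perm_perm (π ρ : Equiv.Perm V) : ∀ X : QTerm V C,
    QTerm.perm π (QTerm.perm ρ X) = QTerm.perm (π * ρ) X
  | .val W => by simp only [QTerm.perm, QValue.perm_perm π ρ W]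
  | .app X Y => by simp only [QTerm.perm, QTerm.perm_perm π ρ X, QTerm.perm_perm π ρ Y]

theorem QValue.perm_perm (π ρ : Equiv.Perm V) : ∀ W : QValue V C,
    QValue.perm π (QValue.perm ρ W) = QValue.perm (π * ρ) W
  | .var x => by simp [QValue.perm]
  | .ct _ => by simp [QValue.perm]
  | .lm x X => by simp [QValue.perm, QTerm.perm_perm π ρ X]
end

mutual
theorem QTerm.perm_one : ∀ X : QTerm V C, QTerm.perm 1 X = X
  | .val W => by simp only [QTerm.perm, QValue.perm_one W]
  | .app X Y => by simp only [QTerm.perm, QTerm.perm_one X, QTerm.perm_one Y]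

theorem QValue.perm_one : ∀ W : QValue V C, QValue.perm 1 W = W
  | .var x => by simp [QValue.perm]
  | .ct _ => by simp [QValue.perm]
  | .lm x X => by simp [QValue.perm, QTerm.perm_one X]
end

variable [DecidableEq V]

/-- Renaming of a bound variable, also allowing the trivial renaming. -/
theorem QValue.Alpha.rename_erase {x y : V} {X : QTerm V C} (hy : y ∉ (QTerm.fv X).erase x) :
    QValue.Alpha (.lm x X) (.lm y (QTerm.perm (Equiv.swap x y) X)) := by
  by_cases hxy : y = x
  · subst hxy
    rw [Equiv.swap_self]
    change QValue.Alpha _ (.lm y (QTerm.perm 1 X))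
    rw [QTerm.perm_one]
    exact .refl _
  · exact .rename fun h => hy (Finset.mem_erase.2 ⟨hxy, h⟩)

mutual
-- Under a binder `x` the images `π x` and `ρ x` may differ. Renaming `π x` to `ρ x` composes `π`
-- with a swap, and this composite agrees with `ρ` on all free variables of the scope, so the
-- induction goes through.
theorem QTerm.perm_alpha : ∀ (π ρ : Equiv.Perm V) (X : QTerm V C),
    (∀ u ∈ QTerm.fv X, π u = ρ u) → QTerm.Alpha (QTerm.perm π X) (QTerm.perm ρ X)
  | π, ρ, .val W, h => by
      simp only [QTerm.perm]
      exact .val (QValue.perm_alpha π ρ W h)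
  | π, ρ, .app X Y, h => by
      simp only [QTerm.perm]
      exact .app (QTerm.perm_alpha π ρ X fun u hu => h u (Finset.mem_union_left _ hu))
        (QTerm.perm_alpha π ρ Y fun u hu => h u (Finset.mem_union_right _ hu))

theorem QValue.perm_alpha : ∀ (π ρ : Equiv.Perm V) (W : QValue V C),
    (∀ u ∈ QValue.fv W, π u = ρ u) → QValue.Alpha (QValue.perm π W) (QValue.perm ρ W)
  | π, ρ, .var x, h => by
      simp only [QValue.perm, h x (by simp [QValue.fv])]
      exact .refl _
  | _, _, .ct _, _ => by
      simp only [QValue.perm]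
      exact .refl _
  | π, ρ, .lm x X, h => by
      have h' : ∀ u ∈ QTerm.fv X, u ≠ x → π u = ρ u := fun u hu hux =>
        h u (Finset.mem_erase.2 ⟨hux, hu⟩)
      simp only [QValue.perm]
      refine (QValue.Alpha.rename_erase (y := ρ x) ?_).trans (.lm ?_)
      · rw [QTerm.fv_perm, ← Finset.image_erase π.injective]
        simp only [Finset.mem_image, Finset.mem_erase, not_exists, not_and, and_imp]
        intro u hux hu e
        rw [h' u hu hux] at e
        exact hux (ρ.injective e)
      · rw [QTerm.perm_perm]
        refine QTerm.perm_alpha _ _ X fun u hu => ?_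
        by_cases hux : u = x
        · subst hux; simp
        · rw [Equiv.Perm.mul_apply, Equiv.swap_apply_of_ne_of_ne (fun e => hux (π.injective e)),
            h' u hu hux]
          rw [h' u hu hux]
          exact fun e => hux (ρ.injective e)
end

theorem QValue.perm_swap_alpha {x y : V} {W : QValue V C} (hx : x ∉ QValue.fv W)
    (hy : y ∉ QValue.fv W) : QValue.Alpha (QValue.perm (Equiv.swap x y) W) W := by
  conv => arg 2; rw [← QValue.perm_one W]
  refine QValue.perm_alpha _ _ W fun u hu => ?_
  exact Equiv.swap_apply_of_ne_of_ne (fun e => hx (e ▸ hu)) (fun e => hy (e ▸ hu))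

omit [DecidableEq V] in
theorem freshVar_notMem [Infinite V] (s : Finset V) : freshVar s ∉ s :=
  Classical.choose_spec (Infinite.exists_notMem_finset s)

variable [Infinite V]

omit [Infinite V] in
theorem mem_imageFv {σ : V → QValue V C} {s : Finset V} {w : V} :
    w ∈ imageFv σ s ↔ ∃ u ∈ s, w ∈ QValue.fv (σ u) := Finset.mem_biUnion

omit [Infinite V] in
theorem mem_imageFv_update {σ : V → QValue V C} {s : Finset V} {w x z : V}
    (h : w ∈ imageFv (Function.update σ x (.var z)) s) : w = z ∨ w ∈ imageFv σ (s.erase x) := by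
  obtain ⟨u, hu, hw⟩ := mem_imageFv.1 h
  by_cases hux : u = x
  · subst hux
    left
    simpa [QValue.fv] using hw
  · rw [Function.update_of_ne hux] at hw
    exact .inr (mem_imageFv.2 ⟨u, Finset.mem_erase.2 ⟨hux, hu⟩, hw⟩)

mutual
theorem QTerm.mem_fv_subst : ∀ (σ : V → QValue V C) (X : QTerm V C) (w : V),
    w ∈ QTerm.fv (QTerm.subst σ X) → w ∈ imageFv σ (QTerm.fv X)
  | σ, .val W, w, h => by
      simp only [QTerm.subst, QTerm.fv] at h ⊢
      exact QValue.mem_fv_subst σ W w h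
  | σ, .app X Y, w, h => by
      simp only [QTerm.subst, QTerm.fv, Finset.mem_union] at h
      simp only [QTerm.fv, imageFv, Finset.union_biUnion, Finset.mem_union]
      exact h.imp (QTerm.mem_fv_subst σ X w) (QTerm.mem_fv_subst σ Y w)

theorem QValue.mem_fv_subst : ∀ (σ : V → QValue V C) (W : QValue V C) (w : V),
    w ∈ QValue.fv (QValue.subst σ W) → w ∈ imageFv σ (QValue.fv W)
  | σ, .var x, w, h => by
      simpa [QValue.subst, QValue.fv, imageFv] using h
  | σ, .ct _, w, h => by simp [QValue.subst, QValue.fv] at h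
  | σ, .lm x X, w, h => by
      simp only [QValue.subst, QValue.fv, Finset.mem_erase] at h ⊢
      exact (mem_imageFv_update (QTerm.mem_fv_subst _ X w h.2)).resolve_left h.1
end

theorem QTerm.subst_alpha_on {σ τ : V → QValue V C} {X : QTerm V C}
    (h : ∀ u ∈ QTerm.fv X, QValue.Alpha (σ u) (τ u)) :
    QTerm.Alpha (QTerm.subst σ X) (QTerm.subst τ X) := by
  -- `QTerm.subst_alpha` asks for equivalence at every variable, so `τ` is first replaced by `σ`
  -- outside the free variables.
  rw [QTerm.subst_congr τ (fun u => if u ∈ QTerm.fv X then τ u else σ u) X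
    fun u hu => by simp [hu]]
  refine QTerm.subst_alpha _ _ X fun u => ?_
  by_cases hu : u ∈ QTerm.fv X
  · simpa [hu] using h u hu
  · simpa [hu] using .refl _

/-- The binder produced by a permuted substitution can be replaced by any fresh variable, provided
permutations commute with substitutions in the scope. -/
theorem QValue.lm_perm_subst_alpha {X : QTerm V C}
    (ih : ∀ (π : Equiv.Perm V) (σ : V → QValue V C),
      QTerm.Alpha (QTerm.perm π (QTerm.subst σ X)) (QTerm.subst (fun u => QValue.perm π (σ u)) X))
    (π : Equiv.Perm V) (σ : V → QValue V C) {x z w : V}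
    (hz : z ∉ imageFv σ ((QTerm.fv X).erase x))
    (hw : w ∉ imageFv (fun u => QValue.perm π (σ u)) ((QTerm.fv X).erase x)) :
    QValue.Alpha (.lm (π z) (QTerm.perm π (QTerm.subst (Function.update σ x (.var z)) X)))
      (.lm w (QTerm.subst (Function.update (fun u => QValue.perm π (σ u)) x (.var w)) X)) := by
  have hπ : ∀ u ∈ (QTerm.fv X).erase x, π z ∉ QValue.fv (QValue.perm π (σ u)) := by
    intro u hu h
    rw [QValue.fv_perm, Finset.mem_image] at h
    obtain ⟨a, ha, e⟩ := h
    exact hz (mem_imageFv.2 ⟨u, hu, π.injective e ▸ ha⟩)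
  refine (QValue.Alpha.rename_erase (y := w) ?_).trans (.lm ?_)
  · rw [QTerm.fv_perm, ← Finset.image_erase π.injective]
    simp only [Finset.mem_image, Finset.mem_erase, not_exists, not_and, and_imp]
    rintro a haz ha rfl
    obtain ⟨u, hu, hau⟩ :=
      mem_imageFv.1 ((mem_imageFv_update (QTerm.mem_fv_subst _ X a ha)).resolve_left haz)
    refine hw (mem_imageFv.2 ⟨u, hu, ?_⟩)
    rw [QValue.fv_perm]
    exact Finset.mem_image_of_mem _ hau
  · rw [QTerm.perm_perm]
    -- The swap of `π z` and `w` sends the binder to `w`; in every other substituted value neither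
    -- variable is free, so there it acts trivially.
    refine (ih _ _).trans (QTerm.subst_alpha_on fun u hu => ?_)
    by_cases hux : u = x
    · subst hux
      simp only [Function.update_self, QValue.perm, Equiv.Perm.mul_apply, Equiv.swap_apply_left]
      exact .refl _
    · have hu' : u ∈ (QTerm.fv X).erase x := Finset.mem_erase.2 ⟨hux, hu⟩
      simp only [Function.update_of_ne hux]
      rw [← QValue.perm_perm]
      exact QValue.perm_swap_alpha (hπ u hu') fun h => hw (mem_imageFv.2 ⟨u, hu', h⟩)

mutual
-- Only alpha-equivalence can hold: the binders that `freshVar` picks on the two sides are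
-- unrelated.
theorem QTerm.perm_subst : ∀ (π : Equiv.Perm V) (σ : V → QValue V C) (X : QTerm V C),
    QTerm.Alpha (QTerm.perm π (QTerm.subst σ X)) (QTerm.subst (fun u => QValue.perm π (σ u)) X)
  | π, σ, .val W => by
      simp only [QTerm.subst, QTerm.perm]
      exact .val (QValue.perm_subst π σ W)
  | π, σ, .app X Y => by
      simp only [QTerm.subst, QTerm.perm]
      exact .app (QTerm.perm_subst π σ X) (QTerm.perm_subst π σ Y)

theorem QValue.perm_subst : ∀ (π : Equiv.Perm V) (σ : V → QValue V C) (W : QValue V C),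
    QValue.Alpha (QValue.perm π (QValue.subst σ W))
      (QValue.subst (fun u => QValue.perm π (σ u)) W)
  | π, σ, .var x => by
      simp only [QValue.subst]
      exact .refl _
  | π, σ, .ct _ => by
      simp only [QValue.subst, QValue.perm]
      exact .refl _
  | π, σ, .lm x X => by
      simp only [QValue.subst, QValue.perm]
      exact QValue.lm_perm_subst_alpha (fun π σ => QTerm.perm_subst π σ X) π σ
        (freshVar_notMem _) (freshVar_notMem _)
end

/-- The identity permutation in `QValue.lm_perm_subst_alpha`. From here on, the particular choice
made by `freshVar` is irrelevant. -/
theorem QValue.subst_lm_alpha (σ : V → QValue V C) {x z : V} {X : QTerm V C}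
    (hz : z ∉ imageFv σ ((QTerm.fv X).erase x)) :
    QValue.Alpha (QValue.subst σ (.lm x X))
      (.lm z (QTerm.subst (Function.update σ x (.var z)) X)) := by
  have h := QValue.lm_perm_subst_alpha (x := x) (w := z) (fun π σ => QTerm.perm_subst π σ X) 1 σ
    (freshVar_notMem _) (by simpa only [QValue.perm_one] using hz)
  simp only [QValue.perm_one, QTerm.perm_one, Equiv.Perm.one_apply] at h
  simpa only [QValue.subst] using h

end RawLemmas

-- Free variables, induction and constructors for alpha-equivalence classes.

section Calculus

variable {V : Type u} {C : Type v} [DecidableEq V]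

/-- The free variables of a term. -/
def Term.fv : Term V C → Finset V :=
  Quotient.lift QTerm.fv fun _ _ h => QTerm.Alpha.fv_eq h

@[simp] theorem Term.fv_Val (W : Value V C) : (Val W).fv = W.fv := by
  induction W using Quotient.ind; rfl

@[simp] theorem Term.fv_App (X Y : Term V C) : (App X Y).fv = X.fv ∪ Y.fv := by
  induction X using Quotient.ind; induction Y using Quotient.ind; rfl

@[simp] theorem Value.fv_Var (x : V) : (Var x : Value V C).fv = {x} := rfl

@[simp] theorem Value.fv_Lm (x : V) (X : Term V C) : (Lm x X).fv = X.fv.erase x := by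
  induction X using Quotient.ind; rfl

mutual
theorem Term.mk_induction {P : Term V C → Prop} (var : ∀ x, P (Val (Var x)))
    (ct : ∀ c, P (Val (Ct c))) (lm : ∀ x X, P X → P (Val (Lm x X)))
    (app : ∀ X Y, P X → P Y → P (App X Y)) : ∀ X : QTerm V C, P (Quotient.mk _ X)
  | .val W => Value.mk_induction var ct lm app W
  | .app X Y => app _ _ (Term.mk_induction var ct lm app X) (Term.mk_induction var ct lm app Y)

theorem Value.mk_induction {P : Term V C → Prop} (var : ∀ x, P (Val (Var x)))
    (ct : ∀ c, P (Val (Ct c))) (lm : ∀ x X, P X → P (Val (Lm x X)))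
    (app : ∀ X Y, P X → P Y → P (App X Y)) : ∀ W : QValue V C, P (Val (Quotient.mk _ W))
  | .var x => var x
  | .ct c => ct c
  | .lm x X => lm x _ (Term.mk_induction var ct lm app X)
end

@[elab_as_elim]
theorem Term.induction {P : Term V C → Prop} (X : Term V C) (var : ∀ x, P (Val (Var x)))
    (ct : ∀ c, P (Val (Ct c))) (lm : ∀ x X, P X → P (Val (Lm x X)))
    (app : ∀ X Y, P X → P Y → P (App X Y)) : P X := by
  induction X using Quotient.ind with
  | _ X => exact Term.mk_induction var ct lm app X

/-! ### Distinctness and injectivity of the constructors -/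

/-- The class of the quasi-value in a quasi-term `Val W`. -/
def QTerm.value? : QTerm V C → Option (Value V C)
  | .val W => some (Quotient.mk _ W)
  | .app _ _ => none

/-- The classes of the operator and operand in a quasi-term `App X Y`. -/
def QTerm.app? : QTerm V C → Option (Term V C × Term V C)
  | .val _ => none
  | .app X Y => some (Quotient.mk _ X, Quotient.mk _ Y)

theorem QTerm.Alpha.value?_eq : ∀ {X Y : QTerm V C}, QTerm.Alpha X Y → X.value? = Y.value?
  | _, _, .refl _ => rfl
  | _, _, .symm h => (QTerm.Alpha.value?_eq h).symm
  | _, _, .trans h h' => (QTerm.Alpha.value?_eq h).trans (QTerm.Alpha.value?_eq h')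
  | _, _, .val h => congrArg some (Quotient.sound h)
  | _, _, .app _ _ => rfl

theorem QTerm.Alpha.app?_eq : ∀ {X Y : QTerm V C}, QTerm.Alpha X Y → X.app? = Y.app?
  | _, _, .refl _ => rfl
  | _, _, .symm h => (QTerm.Alpha.app?_eq h).symm
  | _, _, .trans h h' => (QTerm.Alpha.app?_eq h).trans (QTerm.Alpha.app?_eq h')
  | _, _, .val _ => rfl
  | _, _, .app h h' => congrArg some (Prod.ext (Quotient.sound h) (Quotient.sound h'))

/-- The value in a term `Val W`. -/
def Term.value? : Term V C → Option (Value V C) :=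
  Quotient.lift QTerm.value? fun _ _ h => QTerm.Alpha.value?_eq h

/-- The operator and operand in a term `App X Y`. -/
def Term.app? : Term V C → Option (Term V C × Term V C) :=
  Quotient.lift QTerm.app? fun _ _ h => QTerm.Alpha.app?_eq h

theorem Term.value?_Val (W : Value V C) : (Val W).value? = some W := by
  induction W using Quotient.ind; rfl

theorem Term.app?_Val (W : Value V C) : (Val W).app? = none := by
  induction W using Quotient.ind; rfl

theorem Term.app?_App (X Y : Term V C) : (App X Y).app? = some (X, Y) := by
  induction X using Quotient.ind; induction Y using Quotient.ind; rfl

@[simp] theorem Val_inj {W W' : Value V C} : Val W = Val W' ↔ W = W' :=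
  ⟨fun h => by simpa [Term.value?_Val] using congrArg Term.value? h, congrArg _⟩

@[simp] theorem App_inj {X Y X' Y' : Term V C} : App X Y = App X' Y' ↔ X = X' ∧ Y = Y' :=
  ⟨fun h => by simpa [Term.app?_App] using congrArg Term.app? h, fun h => by rw [h.1, h.2]⟩

@[simp] theorem Val_ne_App (W : Value V C) (X Y : Term V C) : Val W ≠ App X Y :=
  fun h => by simpa [Term.app?_App, Term.app?_Val] using congrArg Term.app? h

@[simp] theorem App_ne_Val (W : Value V C) (X Y : Term V C) : App X Y ≠ Val W :=
  (Val_ne_App W X Y).symm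

variable [Infinite V]

/-- The scope of an abstraction as a function of the value that is put for the bound variable. -/
noncomputable def QValue.body (σ : V → QValue V C) :
    QValue V C → (V ⊕ C) ⊕ (QValue V C → QTerm V C)
  | .var x => .inl (.inl x)
  | .ct c => .inl (.inr c)
  | .lm x X => .inr fun W => QTerm.subst (Function.update σ x W) X

/-- Substitution always renames binders canonically, so alpha-equivalent scopes yield equal
quasi-terms, not merely equivalent ones. This invariant separates the value constructors and
compares equal abstractions. -/
theorem QValue.Alpha.body_eq (σ : V → QValue V C) : ∀ {W W' : QValue V C},
    QValue.Alpha W W' → QValue.body σ W = QValue.body σ W'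
  | _, _, .refl _ => rfl
  | _, _, .symm h => (QValue.Alpha.body_eq σ h).symm
  | _, _, .trans h h' => (QValue.Alpha.body_eq σ h).trans (QValue.Alpha.body_eq σ h')
  | _, _, .lm h => by simp only [QValue.body, QTerm.Alpha.subst_eq h]
  | _, _, .rename (x := x) (y := y) (X := X) hy => by
    simp only [QValue.body, QTerm.subst_perm]
    congr 1
    funext W
    refine QTerm.subst_congr _ _ X fun u hu => ?_
    have huy : u ≠ y := fun h => hy (h ▸ hu)
    by_cases hux : u = x
    · subst hux; simp
    · rw [Equiv.swap_apply_of_ne_of_ne hux huy, Function.update_of_ne hux,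
        Function.update_of_ne huy]

/-! ### Simultaneous substitution -/

/-- Capture-avoiding simultaneous substitution in a term. -/
noncomputable def Term.ssubst (σ : V → Value V C) : Term V C → Term V C :=
  Quotient.map (QTerm.subst fun u => (σ u).out) fun X Y h => by
    rw [QTerm.Alpha.subst_eq h]

/-- Capture-avoiding simultaneous substitution in a value. -/
noncomputable def Value.ssubst (σ : V → Value V C) : Value V C → Value V C :=
  Quotient.map (QValue.subst fun u => (σ u).out) fun X Y h => by
    rw [QValue.Alpha.subst_eq h]

/-- The representatives taken by `Quotient.out` may be replaced by any others. -/
theorem Term.ssubst_mk {σ : V → Value V C} {s : V → QValue V C} (X : QTerm V C)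
    (h : ∀ u ∈ QTerm.fv X, Quotient.mk _ (s u) = σ u) :
    Term.ssubst σ (Quotient.mk _ X) = Quotient.mk _ (QTerm.subst s X) := by
  refine Quotient.sound (QTerm.subst_alpha_on fun u hu => ?_)
  have := h u hu
  rw [← Quotient.out_eq (σ u)] at this
  exact (Quotient.exact this).symm

omit [Infinite V] in
theorem update_mk {σ : V → Value V C} {s : V → QValue V C} (h : ∀ u, Quotient.mk _ (s u) = σ u)
    (x : V) (W : QValue V C) (u : V) :
    Quotient.mk _ (Function.update s x W u) = Function.update σ x (Quotient.mk _ W) u := by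
  by_cases hux : u = x
  · subst hux
    rw [Function.update_self]
    exact (Function.update_self (β := fun _ => Value V C) u _ σ).symm
  · rw [Function.update_of_ne hux]
    exact (h u).trans (Function.update_of_ne (β := fun _ => Value V C) hux _ σ).symm

theorem Term.subst_eq_ssubst (X : Term V C) (W : Value V C) (y : V) :
    X.subst W y = X.ssubst (Function.update Var y W) := by
  induction X using Quotient.ind with
  | _ X =>
  induction W using Quotient.ind with
  | _ W =>
  refine (Term.ssubst_mk X fun u _ => update_mk (fun _ => rfl) y W u).symm

@[simp] theorem Term.ssubst_Val (σ : V → Value V C) (W : Value V C) :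
    (Val W).ssubst σ = Val (W.ssubst σ) := by
  induction W using Quotient.ind with
  | _ W => exact congrArg (Quotient.mk _) (by simp only [QTerm.subst])

@[simp] theorem Term.ssubst_App (σ : V → Value V C) (X Y : Term V C) :
    (App X Y).ssubst σ = App (X.ssubst σ) (Y.ssubst σ) := by
  induction X using Quotient.ind with
  | _ X =>
  induction Y using Quotient.ind with
  | _ Y => exact congrArg (Quotient.mk _) (by simp only [QTerm.subst])

@[simp] theorem Value.ssubst_Var (σ : V → Value V C) (x : V) :
    (Var x : Value V C).ssubst σ = σ x := by
  conv_rhs => rw [← Quotient.out_eq (σ x)]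
  exact congrArg (Quotient.mk _) (by simp only [QValue.subst])

@[simp] theorem Value.ssubst_Ct (σ : V → Value V C) (c : C) :
    (Ct c : Value V C).ssubst σ = Ct c :=
  congrArg (Quotient.mk _) (by simp only [QValue.subst])

omit [Infinite V] in
theorem Value.fv_mk (W : QValue V C) : Value.fv (Quotient.mk _ W) = QValue.fv W := rfl

omit [Infinite V] in
theorem Value.fv_out (W : Value V C) : QValue.fv W.out = W.fv := by
  conv_rhs => rw [← Quotient.out_eq W, Value.fv_mk]

theorem Value.ssubst_Lm {σ : V → Value V C} {x z : V} {X : Term V C}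
    (hz : ∀ u ∈ X.fv.erase x, z ∉ (σ u).fv) :
    (Lm x X).ssubst σ = Lm z (X.ssubst (Function.update σ x (Var z))) := by
  induction X using Quotient.ind with
  | _ X =>
  rw [Term.ssubst_mk (s := Function.update (fun u => (σ u).out) x (.var z))]
  · refine Quotient.sound (QValue.subst_lm_alpha _ fun h => ?_)
    obtain ⟨u, hu, h⟩ := mem_imageFv.1 h
    rw [Value.fv_out] at h
    exact hz u hu h
  · exact fun u _ => update_mk (fun u => Quotient.out_eq (σ u)) x _ u

theorem Term.mem_fv_ssubst {σ : V → Value V C} {X : Term V C} {w : V}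
    (h : w ∈ (X.ssubst σ).fv) : ∃ u ∈ X.fv, w ∈ (σ u).fv := by
  induction X using Quotient.ind with
  | _ X =>
  obtain ⟨u, hu, h⟩ := mem_imageFv.1 (QTerm.mem_fv_subst _ X w h)
  exact ⟨u, hu, by rwa [Value.fv_out] at h⟩

theorem Term.ssubst_congr {σ τ : V → Value V C} {X : Term V C} (h : ∀ u ∈ X.fv, σ u = τ u) :
    X.ssubst σ = X.ssubst τ := by
  induction X using Quotient.ind with
  | _ X =>
  refine congrArg (Quotient.mk _) (QTerm.subst_congr _ _ X fun u hu => ?_)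
  rw [h u hu]

theorem Value.ssubst_congr {σ τ : V → Value V C} {W : Value V C} (h : ∀ u ∈ W.fv, σ u = τ u) :
    W.ssubst σ = W.ssubst τ := by
  rw [← Val_inj, ← Term.ssubst_Val, ← Term.ssubst_Val]
  exact Term.ssubst_congr (by simpa using h)

/-- A variable that is not free in any of the substituted values. -/
theorem exists_fresh (s : Finset V) (σ τ : V → Value V C) (t : Finset V) :
    ∃ z, z ∉ t ∧ (∀ u ∈ s, z ∉ (σ u).fv) ∧ ∀ u ∈ s, z ∉ (τ u).fv := by
  obtain ⟨z, hz⟩ := Infinite.exists_notMem_finset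
    (t ∪ (s.biUnion (fun u => (σ u).fv) ∪ s.biUnion (fun u => (τ u).fv)))
  simp only [Finset.mem_union, Finset.mem_biUnion, not_or, not_exists, not_and] at hz
  exact ⟨z, hz.1, hz.2⟩

@[simp] theorem Term.ssubst_id (X : Term V C) : X.ssubst Var = X := by
  induction X using Term.induction with
  | var x => simp
  | ct c => simp
  | app X Y hX hY => simp [hX, hY]
  | lm x X ih =>
    rw [Term.ssubst_Val, Value.ssubst_Lm (z := x), Function.update_eq_self, ih]
    intro u hu
    simpa using (Finset.ne_of_mem_erase hu).symm

@[simp] theorem Value.ssubst_id (W : Value V C) : W.ssubst Var = W := by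
  rw [← Val_inj, ← Term.ssubst_Val, Term.ssubst_id]

theorem Value.ssubst_of_closed {W : Value V C} (h : W.fv = ∅) (σ : V → Value V C) :
    W.ssubst σ = W := by
  conv_rhs => rw [← Value.ssubst_id W]
  exact Value.ssubst_congr (by simp [h])

theorem Term.ssubst_ssubst (X : Term V C) (σ τ : V → Value V C) :
    (X.ssubst σ).ssubst τ = X.ssubst fun u => (σ u).ssubst τ := by
  induction X using Term.induction generalizing σ τ with
  | var x => simp
  | ct c => simp
  | app X Y hX hY => simp [hX, hY]
  | lm x X ih =>
    obtain ⟨z, -, hz, -⟩ := exists_fresh (X.fv.erase x) σ σ ∅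
    -- The same `w` has to be a legal binder twice: for `τ` applied to the scope already renamed to
    -- `z`, and for the composite substitution.
    obtain ⟨w, hw, hw', -⟩ := exists_fresh (X.fv.erase x) (fun u => (σ u).ssubst τ) σ
      (((X.ssubst (Function.update σ x (Var z))).fv.erase z).biUnion fun u => (τ u).fv)
    simp only [Finset.mem_biUnion, not_exists, not_and] at hw
    rw [Term.ssubst_Val, Value.ssubst_Lm hz, Term.ssubst_Val, Value.ssubst_Lm hw,
      Term.ssubst_Val, Value.ssubst_Lm hw', ih, Val_inj]
    congr 1
    refine Term.ssubst_congr fun u hu => ?_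
    by_cases hux : u = x
    · subst hux; simp
    · simp only [Function.update_of_ne hux]
      refine Value.ssubst_congr fun v hv => ?_
      rw [Function.update_of_ne]
      rintro rfl
      exact hz u (Finset.mem_erase.2 ⟨hux, hu⟩) hv

/-- Freshness of `z` means that the later update at `z` meets only the renamed bound variable, never
a value brought in by `σ`. -/
theorem Term.ssubst_update_ssubst {X : Term V C} {σ τ : V → Value V C} {x z : V} {W : Value V C}
    (hz : ∀ u ∈ X.fv.erase x, z ∉ (σ u).fv) :
    (X.ssubst (Function.update σ x (Var z))).ssubst (Function.update τ z W) =
      X.ssubst (Function.update (fun u => (σ u).ssubst τ) x W) := by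
  rw [Term.ssubst_ssubst]
  refine Term.ssubst_congr fun u hu => ?_
  by_cases hux : u = x
  · subst hux; simp
  · simp only [Function.update_of_ne hux]
    refine Value.ssubst_congr fun v hv => ?_
    rw [Function.update_of_ne]
    rintro rfl
    exact hz u (Finset.mem_erase.2 ⟨hux, hu⟩) hv

/-- The substitution lemma for a simultaneous substitution after a single one, with the bound
variable renamed to a fresh one. -/
theorem Term.ssubst_subst {X : Term V C} {σ : V → Value V C} {x z : V} {W : Value V C}
    (hz : ∀ u ∈ X.fv.erase x, z ∉ (σ u).fv) :
    (X.subst W x).ssubst σ =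
      (X.ssubst (Function.update σ x (Var z))).subst (W.ssubst σ) z := by
  rw [Term.subst_eq_ssubst, Term.subst_eq_ssubst, Term.ssubst_update_ssubst hz,
    Term.ssubst_ssubst]
  refine Term.ssubst_congr fun u _ => ?_
  by_cases hux : u = x
  · subst hux; simp
  · simp [Function.update_of_ne hux]

/-! ### Abstractions -/

theorem Lm_rename {x y : V} {X : Term V C} (hy : y ∉ X.fv.erase x) :
    Lm x X = Lm y (X.subst (Var y) x) := by
  rw [Term.subst_eq_ssubst, ← Value.ssubst_Lm, Value.ssubst_id]
  intro u hu
  rw [Value.fv_Var, Finset.mem_singleton]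
  rintro rfl
  exact hy hu

/-- The function that `QValue.body` attaches to an abstraction is alpha-invariant; so the contractum
is independent of the binder. -/
theorem Lm_eq_subst {x y : V} {X Y : Term V C} (h : Lm x X = Lm y Y) (W : Value V C) :
    X.subst W x = Y.subst W y := by
  induction X using Quotient.ind with
  | _ X =>
  induction Y using Quotient.ind with
  | _ Y =>
  induction W using Quotient.ind with
  | _ W =>
  have := QValue.Alpha.body_eq .var (Quotient.exact h)
  exact congrArg (Quotient.mk _) (congrFun (Sum.inr.inj this) W)

@[simp] theorem Term.subst_self (X : Term V C) (x : V) : X.subst (Var x) x = X := by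
  rw [Term.subst_eq_ssubst, Function.update_eq_self, Term.ssubst_id]

theorem Lm_eq {x y : V} {X Y : Term V C} (h : Lm x X = Lm y Y) : X.subst (Var y) x = Y := by
  rw [Lm_eq_subst h, Term.subst_self]

omit [Infinite V] in
theorem Lm_eq_notMem {x y : V} {X Y : Term V C} (h : Lm x X = Lm y Y) : y ∉ X.fv.erase x := by
  rw [← Value.fv_Lm, h, Value.fv_Lm]
  simp

theorem Value.body_exact {W W' : QValue V C}
    (h : (Quotient.mk _ W : Value V C) = Quotient.mk _ W') :
    QValue.body .var W = QValue.body .var W' :=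
  QValue.Alpha.body_eq .var (Quotient.exact h)

@[simp] theorem Ct_inj {c d : C} : (Ct c : Value V C) = Ct d ↔ c = d :=
  ⟨fun h => Sum.inr.inj (Sum.inl.inj (Value.body_exact h)), congrArg _⟩

@[simp] theorem Var_ne_Ct (x : V) (c : C) : (Var x : Value V C) ≠ Ct c :=
  fun h => Sum.inl_ne_inr (Sum.inl.inj (Value.body_exact h))

@[simp] theorem Ct_ne_Var (x : V) (c : C) : (Ct c : Value V C) ≠ Var x := (Var_ne_Ct x c).symm

@[simp] theorem Var_ne_Lm (x y : V) (X : Term V C) : Var x ≠ Lm y X := by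
  induction X using Quotient.ind with
  | _ X => exact fun h => Sum.inl_ne_inr (Value.body_exact h)

@[simp] theorem Lm_ne_Var (x y : V) (X : Term V C) : Lm y X ≠ Var x := (Var_ne_Lm x y X).symm

@[simp] theorem Ct_ne_Lm (c : C) (y : V) (X : Term V C) : Ct c ≠ Lm y X := by
  induction X using Quotient.ind with
  | _ X => exact fun h => Sum.inl_ne_inr (Value.body_exact h)

@[simp] theorem Lm_ne_Ct (c : C) (y : V) (X : Term V C) : Lm y X ≠ Ct c := (Ct_ne_Lm c y X).symm

end Calculus

section Reduction

variable {V : Type u} {C : Type v} [DecidableEq V] [Infinite V]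

/-! ### Parallel reduction and confluence -/

/-- Parallel call-by-value reduction. -/
inductive Par (Ctapp : C → C → Option (Value V C)) : Term V C → Term V C → Prop
  | var (x : V) : Par Ctapp (Val (Var x)) (Val (Var x))
  | ct (c : C) : Par Ctapp (Val (Ct c)) (Val (Ct c))
  | lm (x : V) {X X' : Term V C} : Par Ctapp X X' → Par Ctapp (Val (Lm x X)) (Val (Lm x X'))
  | app {X X' Y Y' : Term V C} : Par Ctapp X X' → Par Ctapp Y Y' →
      Par Ctapp (App X Y) (App X' Y')
  | beta (x : V) {X X' : Term V C} {W W' : Value V C} : Par Ctapp X X' →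
      Par Ctapp (Val W) (Val W') → Par Ctapp (App (Val (Lm x X)) (Val W)) (X'.subst W' x)
  | delta {c₁ c₂ : C} {W : Value V C} : Ctapp c₁ c₂ = some W →
      Par Ctapp (App (Val (Ct c₁)) (Val (Ct c₂))) (Val W)

variable {Ctapp : C → C → Option (Value V C)}

theorem Par.refl (X : Term V C) : Par Ctapp X X := by
  induction X using Term.induction with
  | var x => exact .var x
  | ct c => exact .ct c
  | lm x X h => exact .lm x h
  | app X Y h h' => exact .app h h'

theorem Red.par {X Y : Term V C} (h : Red Ctapp X Y) : Par Ctapp X Y := by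
  induction h with
  | beta y X W => exact .beta y (.refl X) (.refl _)
  | delta h => exact .delta h
  | appL Y _ ih => exact .app ih (.refl Y)
  | appR X _ ih => exact .app (.refl X) ih
  | xi y _ ih => exact .lm y ih

theorem MRed.app {X X' Y Y' : Term V C} (h : MRed Ctapp X X') (h' : MRed Ctapp Y Y') :
    MRed Ctapp (App X Y) (App X' Y') :=
  (h.lift (fun X => App X Y) fun _ _ h => .appL Y h).trans
    (h'.lift (App X') fun _ _ h => .appR X' h)

theorem MRed.lm (x : V) {X X' : Term V C} (h : MRed Ctapp X X') :
    MRed Ctapp (Val (Lm x X)) (Val (Lm x X')) :=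
  h.lift (fun X => Val (Lm x X)) fun _ _ h => .xi x h

theorem Par.mred {X Y : Term V C} (h : Par Ctapp X Y) : MRed Ctapp X Y := by
  induction h with
  | var | ct => exact .refl
  | lm x _ ih => exact ih.lm x
  | app _ _ ih ih' => exact ih.app ih'
  | beta x _ _ ih ih' => exact ((ih.lm x).app ih').tail (.beta _ _ _)
  | delta h => exact .single (.delta h)

theorem Term.fv_subst_subset (X : Term V C) (W : Value V C) (x : V) :
    (X.subst W x).fv ⊆ X.fv.erase x ∪ W.fv := by
  intro w hw
  rw [Term.subst_eq_ssubst] at hw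
  obtain ⟨u, hu, h⟩ := Term.mem_fv_ssubst hw
  by_cases hux : u = x
  · subst hux
    exact Finset.mem_union_right _ (by simpa using h)
  · rw [Function.update_of_ne hux, Value.fv_Var, Finset.mem_singleton] at h
    subst h
    exact Finset.mem_union_left _ (Finset.mem_erase.2 ⟨hux, hu⟩)

omit [Infinite V] in
theorem update_rel {R : Term V C → Term V C → Prop} {σ τ : V → Value V C}
    (h : ∀ u, R (Val (σ u)) (Val (τ u))) (x : V) {W W' : Value V C} (hW : R (Val W) (Val W'))
    (u : V) : R (Val (Function.update σ x W u)) (Val (Function.update τ x W' u)) := by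
  by_cases hux : u = x
  · subst hux; simpa using hW
  · rw [Function.update_of_ne hux, Function.update_of_ne hux]; exact h u

-- Parallel reduction and substitution.

section Closed

variable (hclosed : ∀ c₁ c₂ W, Ctapp c₁ c₂ = some W → W.fv = ∅)
include hclosed

/-- This supplies the freshness condition when a reduct is displayed with a prescribed binder. -/
theorem Par.fv_subset {X Y : Term V C} (h : Par Ctapp X Y) : Y.fv ⊆ X.fv := by
  induction h with
  | var | ct => exact subset_rfl
  | lm x _ ih => simpa using Finset.erase_subset_erase x ih
  | app _ _ ih ih' => simpa using Finset.union_subset_union ih ih'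
  | beta x _ _ ih ih' =>
    refine (Term.fv_subst_subset _ _ _).trans ?_
    simpa using Finset.union_subset_union (Finset.erase_subset_erase x ih) (by simpa using ih')
  | delta h => simp [hclosed _ _ _ h]

/-- Letting the substituted values reduce at the same time is what the β case of the diamond
property requires. In the binder cases one `z` is chosen fresh for both sides. -/
theorem Par.ssubst {X X' : Term V C} (h : Par Ctapp X X') {σ τ : V → Value V C}
    (hστ : ∀ u, Par Ctapp (Val (σ u)) (Val (τ u))) :
    Par Ctapp (X.ssubst σ) (X'.ssubst τ) := by
  induction h generalizing σ τ with
  | var x => simpa using hστ x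
  | ct c => simpa using .ct c
  | app _ _ ih ih' => simpa using .app (ih hστ) (ih' hστ)
  | @lm x X X' h ih =>
    obtain ⟨z, -, hz, hz'⟩ := exists_fresh (X.fv.erase x ∪ X'.fv.erase x) σ τ ∅
    rw [Term.ssubst_Val, Value.ssubst_Lm fun u hu => hz u (Finset.mem_union_left _ hu),
      Term.ssubst_Val, Value.ssubst_Lm fun u hu => hz' u (Finset.mem_union_right _ hu)]
    exact .lm z (ih (update_rel (R := Par Ctapp) hστ x (.var z)))
  | @beta x X X' W W' _ _ ih ih' =>
    obtain ⟨z, -, hz, hz'⟩ := exists_fresh (X.fv.erase x ∪ X'.fv.erase x) σ τ ∅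
    rw [Term.ssubst_App, Term.ssubst_Val, Term.ssubst_Val,
      Value.ssubst_Lm fun u hu => hz u (Finset.mem_union_left _ hu),
      Term.ssubst_subst fun u hu => hz' u (Finset.mem_union_right _ hu)]
    exact .beta z (ih (update_rel (R := Par Ctapp) hστ x (.var z))) (by simpa using ih' hστ)
  | delta h =>
    rw [Term.ssubst_Val, Value.ssubst_of_closed (hclosed _ _ _ h)]
    simpa using .delta h

theorem Par.subst {X X' : Term V C} {W W' : Value V C} (h : Par Ctapp X X')
    (hW : Par Ctapp (Val W) (Val W')) (x : V) : Par Ctapp (X.subst W x) (X'.subst W' x) := by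
  rw [Term.subst_eq_ssubst, Term.subst_eq_ssubst]
  exact h.ssubst hclosed (update_rel (R := Par Ctapp) (fun _ => Par.refl _) x hW)

/-! ### Inversion of parallel reduction -/

omit hclosed in
theorem Par.val_inv {W : Value V C} {Y : Term V C} (h : Par Ctapp (Val W) Y) :
    ∃ W', Y = Val W' := by
  generalize hX : Val W = X at h
  cases h with
  | var | ct | lm => exact ⟨_, rfl⟩
  | app | beta | delta => simp at hX

omit hclosed in
theorem Par.ct_inv {c : C} {Y : Term V C} (h : Par Ctapp (Val (Ct c)) Y) : Y = Val (Ct c) := by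
  generalize hX : (Val (Ct c) : Term V C) = X at h
  cases h <;> simp_all

/-- The derivation may use another binder `y`. Since reduction creates no free variables, `x` is
fresh for the reduct as well, and renaming `y` to `x` preserves the step. -/
theorem Par.lm_inv {x : V} {X Y : Term V C} (h : Par Ctapp (Val (Lm x X)) Y) :
    ∃ X', Y = Val (Lm x X') ∧ Par Ctapp X X' := by
  generalize hZ : Val (Lm x X) = Z at h
  cases h with
  | var | ct | app | beta | delta => simp at hZ
  | @lm y P P' h =>
    rw [Val_inj] at hZ
    refine ⟨P'.subst (Var x) y, ?_, ?_⟩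
    · rw [Lm_rename]
      exact fun hx => Lm_eq_notMem hZ.symm
        (Finset.erase_subset_erase y (h.fv_subset hclosed) hx)
    · rw [← Lm_eq hZ.symm]
      exact h.subst hclosed (.refl _) y

omit hclosed in
theorem Par.app_inv {X Y Z : Term V C} (h : Par Ctapp (App X Y) Z) :
    (∃ X' Y', Z = App X' Y' ∧ Par Ctapp X X' ∧ Par Ctapp Y Y') ∨
    (∃ x P P' W W', X = Val (Lm x P) ∧ Y = Val W ∧ Z = P'.subst W' x ∧
      Par Ctapp P P' ∧ Par Ctapp (Val W) (Val W')) ∨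
    ∃ c₁ c₂ W, X = Val (Ct c₁) ∧ Y = Val (Ct c₂) ∧ Z = Val W ∧ Ctapp c₁ c₂ = some W := by
  generalize hU : App X Y = U at h
  cases h with
  | var | ct | lm => simp at hU
  | app h h' =>
    rw [App_inj] at hU
    obtain ⟨rfl, rfl⟩ := hU
    exact .inl ⟨_, _, rfl, h, h'⟩
  | beta x h h' =>
    rw [App_inj] at hU
    exact .inr (.inl ⟨x, _, _, _, _, hU.1, hU.2, rfl, h, h'⟩)
  | delta h =>
    rw [App_inj] at hU
    exact .inr (.inr ⟨_, _, _, hU.1, hU.2, rfl, h⟩)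

/-- A parallel reduction of an abstraction is one of its scope, up to the choice of binders. -/
theorem Par.lm_lm {x y : V} {X Y : Term V C} (h : Par Ctapp (Val (Lm x X)) (Val (Lm y Y))) :
    ∃ X', Lm y Y = Lm x X' ∧ Par Ctapp X X' := by
  obtain ⟨X', e, h⟩ := h.lm_inv hclosed
  exact ⟨X', Val_inj.1 e, h⟩

theorem Par.subst_of_lm {x y : V} {P Q : Term V C} {W W' : Value V C}
    (h : Par Ctapp (Val (Lm x P)) (Val (Lm y Q))) (hW : Par Ctapp (Val W) (Val W')) :
    Par Ctapp (P.subst W x) (Q.subst W' y) := by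
  obtain ⟨X', e, h⟩ := h.lm_lm hclosed
  rw [Lm_eq_subst e]
  exact h.subst hclosed hW x

/-- When a redex is contracted on one side only, the other side has reduced inside it. Abstractions,
values and constants keep their form, so the redex is still there and can be contracted;
compatibility with substitution closes the square. -/
theorem Par.confluent : Confluent (Par Ctapp) := by
  intro X Y Z h
  induction h generalizing Z with
  | var x => exact fun h => ⟨Z, h, .refl Z⟩
  | ct c => exact fun h => ⟨Z, h, .refl Z⟩
  | lm x h ih =>
    intro h'
    obtain ⟨X', rfl, hX'⟩ := h'.lm_inv hclosed
    obtain ⟨Q, h₁, h₂⟩ := ih _ hX'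
    exact ⟨_, .lm x h₁, .lm x h₂⟩
  | @app X X' Y Y' hX hY ihX ihY =>
    intro h'
    obtain ⟨X₂, Y₂, rfl, hX₂, hY₂⟩ | ⟨x, P, P', W, W', rfl, rfl, rfl, hP, hW⟩ |
      ⟨c₁, c₂, W, rfl, rfl, rfl, hc⟩ := h'.app_inv
    · obtain ⟨X₃, h₁, h₂⟩ := ihX _ hX₂
      obtain ⟨Y₃, h₁', h₂'⟩ := ihY _ hY₂
      exact ⟨_, .app h₁ h₁', .app h₂ h₂'⟩
    · obtain ⟨P₁, rfl, hP₁⟩ := hX.lm_inv hclosed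
      obtain ⟨W₁, rfl⟩ := hY.val_inv
      -- The induction hypothesis concerns the whole abstraction, so its scope's reduct is recovered
      -- by inversion.
      obtain ⟨X₃, h₁, h₂⟩ := ihX _ (.lm x hP)
      obtain ⟨Y₃, h₁', h₂'⟩ := ihY _ hW
      obtain ⟨P₃, rfl, hP₃⟩ := h₁.lm_inv hclosed
      obtain ⟨W₃, rfl⟩ := h₁'.val_inv
      exact ⟨_, .beta x hP₃ h₁', h₂.subst_of_lm hclosed h₂'⟩
    · obtain rfl := hX.ct_inv
      obtain rfl := hY.ct_inv
      exact ⟨_, .delta hc, .refl _⟩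
  | @beta x P P' W W' hP hW ihP ihW =>
    intro h'
    obtain ⟨X₂, Y₂, rfl, hX₂, hY₂⟩ | ⟨y, Q, Q', U, U', hQ, hU, rfl, hQ', hU'⟩ |
      ⟨c₁, c₂, W, h, -⟩ := h'.app_inv
    · obtain ⟨P₂, rfl, hP₂⟩ := hX₂.lm_inv hclosed
      obtain ⟨W₂, rfl⟩ := hY₂.val_inv
      obtain ⟨P₃, h₁, h₂⟩ := ihP _ hP₂
      obtain ⟨Y₃, h₁', h₂'⟩ := ihW _ hY₂
      obtain ⟨W₃, rfl⟩ := h₁'.val_inv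
      exact ⟨_, h₁.subst hclosed h₁' x, .beta x h₂ h₂'⟩
    · rw [Val_inj] at hQ hU
      subst hU
      -- The two contractions may display the same abstraction with different binders; the second is
      -- brought back to `x`.
      obtain ⟨P₂, e, hP₂⟩ : ∃ P₂, Lm y Q' = Lm x P₂ ∧ Par Ctapp P P₂ :=
        Par.lm_lm hclosed (by rw [hQ]; exact .lm y hQ')
      rw [Lm_eq_subst e]
      obtain ⟨P₃, h₁, h₂⟩ := ihP _ hP₂
      obtain ⟨Y₃, h₁', h₂'⟩ := ihW _ hU'
      obtain ⟨W₃, rfl⟩ := h₁'.val_inv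
      exact ⟨_, h₁.subst hclosed h₁' x, h₂.subst hclosed h₂' x⟩
    · simp at h
  | @delta c₁ c₂ W hc =>
    intro h'
    obtain ⟨X₂, Y₂, rfl, hX₂, hY₂⟩ | ⟨y, Q, Q', U, U', hQ, -⟩ |
      ⟨d₁, d₂, W', h₁, h₂, rfl, hd⟩ := h'.app_inv
    · obtain rfl := hX₂.ct_inv
      obtain rfl := hY₂.ct_inv
      exact ⟨_, .refl _, .delta hc⟩
    · simp at hQ
    · simp only [Val_inj, Ct_inj] at h₁ h₂
      subst h₁ h₂
      obtain rfl := Option.some.inj (hc.symm.trans hd)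
      exact ⟨_, .refl _, .refl _⟩

theorem MRed.confluent : Confluent (MRed Ctapp) := by
  have e : MRed Ctapp = Relation.ReflTransGen (Par Ctapp) := by
    funext X Y
    refine propext ⟨fun h => h.lift id fun _ _ => Red.par, fun h => ?_⟩
    induction h with
    | refl => exact .refl
    | tail _ h ih => exact ih.trans h.mred
  rw [e]
  intro X Y Z hY hZ
  refine Relation.church_rosser (fun a b c hb hc => ?_) hY hZ
  obtain ⟨d, h, h'⟩ := Par.confluent hclosed a b c hb hc
  exact ⟨d, .single h, .single h'⟩

end Closed

/-! ### Standardization -/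

/-- `Std Ctapp X Y`: left reduction from `X`, followed by reductions of the same kind inside the
immediate subterms, leads to `Y`. -/
inductive Std (Ctapp : C → C → Option (Value V C)) : Term V C → Term V C → Prop
  | var {X : Term V C} (x : V) : Relation.ReflTransGen (LRed Ctapp) X (Val (Var x)) →
      Std Ctapp X (Val (Var x))
  | ct {X : Term V C} (c : C) : Relation.ReflTransGen (LRed Ctapp) X (Val (Ct c)) →
      Std Ctapp X (Val (Ct c))
  | lm {X P P' : Term V C} (x : V) : Relation.ReflTransGen (LRed Ctapp) X (Val (Lm x P)) →
      Std Ctapp P P' → Std Ctapp X (Val (Lm x P'))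
  | app {X P P' Q Q' : Term V C} : Relation.ReflTransGen (LRed Ctapp) X (App P Q) →
      Std Ctapp P P' → Std Ctapp Q Q' → Std Ctapp X (App P' Q')

theorem LRed.red {X Y : Term V C} (h : LRed Ctapp X Y) : Red Ctapp X Y := by
  induction h with
  | delta h => exact .delta h
  | beta y X W => exact .beta y X W
  | appL Y _ ih => exact .appL Y ih
  | appR W _ ih => exact .appR _ ih

theorem Std.refl (X : Term V C) : Std Ctapp X X := by
  induction X using Term.induction with
  | var x => exact .var x .refl
  | ct c => exact .ct c .refl
  | lm x X h => exact .lm x .refl h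
  | app X Y h h' => exact .app .refl h h'

theorem Std.head {X Y Z : Term V C} (h : Relation.ReflTransGen (LRed Ctapp) X Y)
    (h' : Std Ctapp Y Z) : Std Ctapp X Z := by
  cases h' with
  | var x h' => exact .var x (h.trans h')
  | ct c h' => exact .ct c (h.trans h')
  | lm x h' hP => exact .lm x (h.trans h') hP
  | app h' hP hQ => exact .app (h.trans h') hP hQ

/-! ### Inversion of one-step reduction -/

theorem Red.app_inv {X Y Z : Term V C} (h : Red Ctapp (App X Y) Z) :
    (∃ X', Z = App X' Y ∧ Red Ctapp X X') ∨ (∃ Y', Z = App X Y' ∧ Red Ctapp Y Y') ∨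
    (∃ x P W, X = Val (Lm x P) ∧ Y = Val W ∧ Z = P.subst W x) ∨
    ∃ c₁ c₂ W, X = Val (Ct c₁) ∧ Y = Val (Ct c₂) ∧ Z = Val W ∧ Ctapp c₁ c₂ = some W := by
  generalize hU : App X Y = U at h
  cases h with
  | xi => simp at hU
  | appL _ h =>
    rw [App_inj] at hU
    obtain ⟨rfl, rfl⟩ := hU
    exact .inl ⟨_, rfl, h⟩
  | appR _ h =>
    rw [App_inj] at hU
    obtain ⟨rfl, rfl⟩ := hU
    exact .inr (.inl ⟨_, rfl, h⟩)
  | beta x P W =>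
    rw [App_inj] at hU
    exact .inr (.inr (.inl ⟨x, P, W, hU.1, hU.2, rfl⟩))
  | delta h =>
    rw [App_inj] at hU
    exact .inr (.inr (.inr ⟨_, _, _, hU.1, hU.2, rfl, h⟩))

theorem Red.val_inv {W : Value V C} {Z : Term V C} (h : Red Ctapp (Val W) Z) :
    ∃ x P Q, W = Lm x P ∧ Z = Val (Lm x Q) ∧ Red Ctapp P Q := by
  generalize hU : Val W = U at h
  cases h with
  | xi y h => exact ⟨y, _, _, Val_inj.1 hU, rfl, h⟩
  | beta | delta | appL | appR => simp at hU

-- Standard reduction under substitution and under a further step.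

section Closed

variable (hclosed : ∀ c₁ c₂ W, Ctapp c₁ c₂ = some W → W.fv = ∅)
include hclosed

theorem Red.ssubst {X Y : Term V C} (h : Red Ctapp X Y) (σ : V → Value V C) :
    Red Ctapp (X.ssubst σ) (Y.ssubst σ) := by
  induction h generalizing σ with
  | appL Y _ ih => simpa using .appL _ (ih σ)
  | appR X _ ih => simpa using .appR _ (ih σ)
  | @xi x X X' h ih =>
    obtain ⟨z, -, hz, -⟩ := exists_fresh (X.fv.erase x ∪ X'.fv.erase x) σ σ ∅
    rw [Term.ssubst_Val, Value.ssubst_Lm fun u hu => hz u (Finset.mem_union_left _ hu),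
      Term.ssubst_Val, Value.ssubst_Lm fun u hu => hz u (Finset.mem_union_right _ hu)]
    exact .xi z (ih _)
  | beta x X W =>
    obtain ⟨z, -, hz, -⟩ := exists_fresh (X.fv.erase x) σ σ ∅
    rw [Term.ssubst_App, Term.ssubst_Val, Term.ssubst_Val, Value.ssubst_Lm hz,
      Term.ssubst_subst hz]
    exact .beta z _ _
  | delta h =>
    rw [Term.ssubst_Val, Value.ssubst_of_closed (hclosed _ _ _ h)]
    simpa using .delta h

theorem LRed.ssubst {X Y : Term V C} (h : LRed Ctapp X Y) (σ : V → Value V C) :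
    LRed Ctapp (X.ssubst σ) (Y.ssubst σ) := by
  induction h with
  | appL Y _ ih => simpa using .appL _ ih
  | appR X _ ih => simpa using .appR _ ih
  | beta x X W =>
    obtain ⟨z, -, hz, -⟩ := exists_fresh (X.fv.erase x) σ σ ∅
    rw [Term.ssubst_App, Term.ssubst_Val, Term.ssubst_Val, Value.ssubst_Lm hz,
      Term.ssubst_subst hz]
    exact .beta z _ _
  | delta h =>
    rw [Term.ssubst_Val, Value.ssubst_of_closed (hclosed _ _ _ h)]
    simpa using .delta h

theorem Red.lm_inv {x : V} {X Z : Term V C} (h : Red Ctapp (Val (Lm x X)) Z) :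
    ∃ X', Z = Val (Lm x X') ∧ Red Ctapp X X' := by
  obtain ⟨y, P, Q, e, rfl, hPQ⟩ := h.val_inv
  refine ⟨Q.subst (Var x) y, ?_, ?_⟩
  · rw [Lm_rename]
    exact fun hx => Lm_eq_notMem e.symm
      (Finset.erase_subset_erase y (hPQ.par.fv_subset hclosed) hx)
  · rw [← Lm_eq e.symm, Term.subst_eq_ssubst, Term.subst_eq_ssubst]
    exact hPQ.ssubst hclosed _

theorem LRed.reflTransGen_ssubst {X Y : Term V C} (h : Relation.ReflTransGen (LRed Ctapp) X Y)
    (σ : V → Value V C) : Relation.ReflTransGen (LRed Ctapp) (X.ssubst σ) (Y.ssubst σ) :=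
  h.lift (Term.ssubst σ) fun _ _ h => h.ssubst hclosed σ

/-- Left reduction is stable under substitution, so the initial left steps carry over. At a variable
they end in the substituted value, where the given standard reduction takes over. -/
theorem Std.ssubst {X X' : Term V C} (h : Std Ctapp X X') {σ τ : V → Value V C}
    (hστ : ∀ u, Std Ctapp (Val (σ u)) (Val (τ u))) :
    Std Ctapp (X.ssubst σ) (X'.ssubst τ) := by
  induction h generalizing σ τ with
  | var x h =>
    refine .head (LRed.reflTransGen_ssubst hclosed h σ) ?_
    simpa using hστ x
  | ct c h =>
    refine .head (LRed.reflTransGen_ssubst hclosed h σ) ?_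
    simpa using .refl _
  | app h _ _ ih ih' =>
    refine .head (LRed.reflTransGen_ssubst hclosed h σ) ?_
    simpa using .app .refl (ih hστ) (ih' hστ)
  | @lm _ X X' x h _ ih =>
    refine .head (LRed.reflTransGen_ssubst hclosed h σ) ?_
    obtain ⟨z, -, hz, hz'⟩ := exists_fresh (X.fv.erase x ∪ X'.fv.erase x) σ τ ∅
    rw [Term.ssubst_Val, Value.ssubst_Lm fun u hu => hz u (Finset.mem_union_left _ hu),
      Term.ssubst_Val, Value.ssubst_Lm fun u hu => hz' u (Finset.mem_union_right _ hu)]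
    exact .lm z .refl (ih (update_rel (R := Std Ctapp) hστ x (.refl _)))

theorem Std.subst {X X' : Term V C} {W W' : Value V C} (h : Std Ctapp X X')
    (hW : Std Ctapp (Val W) (Val W')) (x : V) : Std Ctapp (X.subst W x) (X'.subst W' x) := by
  rw [Term.subst_eq_ssubst, Term.subst_eq_ssubst]
  exact h.ssubst hclosed (update_rel (R := Std Ctapp) (fun _ => Std.refl _) x hW)

omit hclosed in
-- If the end is a value, left reduction alone already reaches a value; the rest happens inside it.
theorem Std.val_inv {X : Term V C} {W : Value V C} (h : Std Ctapp X (Val W)) :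
    ∃ W₀, Relation.ReflTransGen (LRed Ctapp) X (Val W₀) ∧ Std Ctapp (Val W₀) (Val W) := by
  generalize hY : Val W = Y at h
  cases h with
  | var x h => exact ⟨_, h, .refl _⟩
  | ct c h => exact ⟨_, h, .refl _⟩
  | lm x h hP => exact ⟨_, h, .lm x .refl hP⟩
  | app => simp at hY

omit hclosed in
theorem Std.ct_inv {X : Term V C} {c : C} (h : Std Ctapp X (Val (Ct c))) :
    Relation.ReflTransGen (LRed Ctapp) X (Val (Ct c)) := by
  generalize hY : (Val (Ct c) : Term V C) = Y at h
  cases h with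
  | ct c h => exact h
  | var | lm | app => simp at hY

omit hclosed in
theorem Std.lm_inv {X P : Term V C} {y : V} (h : Std Ctapp X (Val (Lm y P))) :
    ∃ x Q Q', Relation.ReflTransGen (LRed Ctapp) X (Val (Lm x Q)) ∧ Std Ctapp Q Q' ∧
      Lm x Q' = Lm y P := by
  generalize hY : Val (Lm y P) = Y at h
  cases h with
  | lm x h hP => exact ⟨x, _, _, h, hP, (Val_inj.1 hY).symm⟩
  | var | ct | app => simp at hY

omit hclosed in
theorem LRed.reflTransGen_app {X Y Z : Term V C} {W : Value V C}
    (h : Relation.ReflTransGen (LRed Ctapp) X (Val W))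
    (h' : Relation.ReflTransGen (LRed Ctapp) Y Z) :
    Relation.ReflTransGen (LRed Ctapp) (App X Y) (App (Val W) Z) :=
  (h.lift (fun X => App X Y) fun _ _ h => .appL Y h).trans
    (h'.lift (App (Val W)) fun _ _ h => .appR W h)

/-- A step in a proper subterm is absorbed by induction. If the step contracts the root, left
reduction can expose an ancestor of that redex and contract it first, postponing the inner
reductions. -/
theorem Std.tail {X Y Z : Term V C} (h : Std Ctapp X Y) (h' : Red Ctapp Y Z) :
    Std Ctapp X Z := by
  induction h generalizing Z with
  | var x h => obtain ⟨y, P, Q, e, -⟩ := h'.val_inv; simp at e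
  | ct c h => obtain ⟨y, P, Q, e, -⟩ := h'.val_inv; simp at e
  | lm x h hP ih =>
    obtain ⟨Q, rfl, hQ⟩ := h'.lm_inv hclosed
    exact .lm x h (ih hQ)
  | app h hP hQ ihP ihQ =>
    obtain ⟨X', rfl, hX⟩ | ⟨Y', rfl, hY⟩ | ⟨x, P, W, rfl, rfl, rfl⟩ |
      ⟨c₁, c₂, W, rfl, rfl, rfl, hc⟩ := h'.app_inv
    · exact .app h (ihP hX) hQ
    · exact .app h hP (ihQ hY)
    · obtain ⟨y, R, R', hR, hR', e⟩ := hP.lm_inv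
      obtain ⟨W₀, hW, hW'⟩ := hQ.val_inv
      rw [← Lm_eq_subst e]
      -- Left reduction brings the operator to an abstraction, then the operand to a value, then
      -- fires β. The postponed reductions of scope and argument are combined by `Std.subst`.
      exact .head ((h.trans (LRed.reflTransGen_app hR hW)).tail (.beta _ _ _))
        (hR'.subst hclosed hW' y)
    · exact .head ((h.trans (LRed.reflTransGen_app hP.ct_inv hQ.ct_inv)).tail (.delta hc))
        (.refl _)

theorem MRed.std {X Y : Term V C} (h : MRed Ctapp X Y) : Std Ctapp X Y := by
  induction h with
  | refl => exact .refl X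
  | tail _ h ih => exact ih.tail hclosed h

end Closed

/-! ### Standard reduction sequences -/

/-- Each left step is put in front by the rule `Srs.red`, starting from the end of the left
reduction. -/
theorem Srs.exists_reflTransGen {X Y Z : Term V C}
    (h : Relation.ReflTransGen (LRed Ctapp) X Y)
    (h' : ∃ Xs, Srs Ctapp Xs ∧ Xs.head? = some Y ∧ Xs.getLast? = some Z) :
    ∃ Xs, Srs Ctapp Xs ∧ Xs.head? = some X ∧ Xs.getLast? = some Z := by
  induction h using Relation.ReflTransGen.head_induction_on with
  | refl => exact h'
  | @head X X' h _ ih =>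
    obtain ⟨Xs, hs, hh, hl⟩ := ih
    refine ⟨X :: Xs, .red hh h hs, rfl, ?_⟩
    rw [List.getLast?_cons, hl]
    rfl

omit [Infinite V] in
theorem head?_zipApp {Xs Ys : List (Term V C)} {X Y : Term V C} (hX : Xs.head? = some X)
    (hY : Ys.head? = some Y) : (zipApp Xs Ys).head? = some (App X Y) := by
  cases Xs <;> cases Ys <;> simp_all [zipApp]

omit [Infinite V] in
theorem getLast?_zipApp {Xs Ys : List (Term V C)} {X Y : Term V C} (hX : Xs.getLast? = some X)
    (hY : Ys.getLast? = some Y) : (zipApp Xs Ys).getLast? = some (App X Y) := by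
  cases Xs with
  | nil => simp at hX
  | cons A Xs =>
    cases Ys with
    | nil => simp at hY
    | cons B Ys =>
      have e : (A :: Xs).getLast (List.cons_ne_nil A Xs) = X :=
        Option.some.inj ((List.getLast?_eq_some_getLast _).symm.trans hX)
      simp only [zipApp, e, List.getLast?_append, List.getLast?_map, hX]
      rw [List.getLast?_cons] at hY
      -- If `Ys` is empty, the last entry comes from the first phase, and its operand `B` is `Y`.
      cases h : Ys.getLast? <;> simp_all

theorem Std.exists_srs {X Y : Term V C} (h : Std Ctapp X Y) :
    ∃ Xs, Srs Ctapp Xs ∧ Xs.head? = some X ∧ Xs.getLast? = some Y := by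
  induction h with
  | var x h => exact Srs.exists_reflTransGen h ⟨_, .var x, rfl, rfl⟩
  | ct c h => exact Srs.exists_reflTransGen h ⟨_, .ct c, rfl, rfl⟩
  | lm x h _ ih =>
    obtain ⟨Xs, hs, hh, hl⟩ := ih
    exact Srs.exists_reflTransGen h ⟨_, .lm x hs, by simp [hh], by simp [hl]⟩
  | app h _ _ ih ih' =>
    obtain ⟨Xs, hs, hh, hl⟩ := ih
    obtain ⟨Ys, hs', hh', hl'⟩ := ih'
    exact Srs.exists_reflTransGen h
      ⟨_, .app hs hs', head?_zipApp hh hh', getLast?_zipApp hl hl'⟩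

/-- The existence of both ends is part of the induction: it shows the lists nonempty, without which
`zipApp` would return its default `[]`. -/
theorem Srs.exists_mred {Xs : List (Term V C)} (h : Srs Ctapp Xs) :
    ∃ X Y, Xs.head? = some X ∧ Xs.getLast? = some Y ∧ MRed Ctapp X Y := by
  induction h with
  | ct c => exact ⟨_, _, rfl, rfl, .refl⟩
  | var x => exact ⟨_, _, rfl, rfl, .refl⟩
  | @red X Y Xs hh h _ ih =>
    obtain ⟨X', Z, hh', hl, ih⟩ := ih
    obtain rfl := Option.some.inj (hh.symm.trans hh')
    refine ⟨X, Z, rfl, ?_, .head h.red ih⟩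
    rw [List.getLast?_cons, hl]
    rfl
  | lm x _ ih =>
    obtain ⟨X, Y, hh, hl, ih⟩ := ih
    exact ⟨_, _, by simp [hh], by simp [hl], ih.lm x⟩
  | app _ _ ih ih' =>
    obtain ⟨X, Y, hh, hl, ih⟩ := ih
    obtain ⟨X', Y', hh', hl', ih'⟩ := ih'
    exact ⟨_, _, head?_zipApp hh hh', getLast?_zipApp hl hl', ih.app ih'⟩

end Reduction

end CBV

theorem theorem5 {V : Type*} {C : Type*} [DecidableEq V] [Infinite V]
    (Ctapp : C → C → Option (CBV.Value V C))
    (hclosed : ∀ c₁ c₂ W, Ctapp c₁ c₂ = some W → W.fv = ∅) :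
    CBV.Confluent (CBV.MRed Ctapp) ∧
    ∀ X X' : CBV.Term V C, CBV.MRed Ctapp X X' ↔
      ∃ Xs : List (CBV.Term V C),
        CBV.Srs Ctapp Xs ∧ Xs.head? = some X ∧ Xs.getLast? = some X' := by
  refine ⟨CBV.MRed.confluent hclosed, fun X X' => ⟨fun h => (h.std hclosed).exists_srs, ?_⟩⟩
  rintro ⟨Xs, hs, hh, hl⟩
  obtain ⟨Y, Y', hh', hl', h⟩ := hs.exists_mred
  obtain rfl := Option.some.inj (hh.symm.trans hh')
  obtain rfl := Option.some.inj (hl.symm.trans hl')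
  exact h
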